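/- Let $\&$ be a continuous t-norm, i.e. a continuous map $\&\colon[0,1]^2\to[0,1]$ making $([0,1],\&,1)$ a commutative unital quantale (a commutative monoid with unit $1$ in which $\&$ distributes over arbitrary joins), and let $\to$ be its implication, determined by $p\,\&\,q\le r\iff q\le p\to r$. A $[0,1]$-order on a set $X$ is a map $X(\cdot,\cdot)\colon X\times X\to[0,1]$ with $X(x,x)=1$ and $X(y,z)\,\&\,X(x,y)\le X(x,z)$. On $[0,1]$ consider the $[0,1]$-orders $\alpha_L(x,y)=x\to y$ and $\alpha_R(x,y)=y\to x$. A weight of $X$ is a map $\phi\colon X\to[0,1]$ with $\phi(y)\,\&\,X(x,y)\le\phi(x)$ for all $x,y$. Put $\mathrm{sub}_X(\phi,\psi)=\bigwedge_{x}(\phi(x)\to\psi(x))$. A supremum of a weight $\phi$ is an element $a\in X$ with $X(a,y)=\mathrm{sub}_X(\phi,X(-,y))$ for all $y\in X$. A weight $\phi$ is forward Cauchy if $\phi=\bigvee_i\bigwedge_{j\ge i}X(-,x_j)$ for some net $(x_i)$ in $X$ with $\bigvee_i\bigwedge_{i\le j\le l}X(x_j,x_l)=1$. For a map $f\colon X\to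 Y$ between $[0,1]$-ordered sets put $f^{\to}(\phi)(y)=\bigvee_{x}\phi(x)\,\&\,Y(y,f(x))$. The map $f$ is $[0,1]$-Scott continuous if $X(x,y)\le Y(f(x),f(y))$ for all $x,y$ and, for every forward Cauchy weight $\phi$ of $X$ and every supremum $a$ of $\phi$, the element $f(a)$ is a supremum of $f^{\to}(\phi)$. A weight $\phi$ of $X$ is Scott closed if it is $[0,1]$-Scott continuous as a map $X\to([0,1],\alpha_R)$. A $[0,1]$-approach space is a set $X$ with a map $\delta\colon X\times 2^X\to[0,1]$ such that, for all $x\in X$ and $A,B\subseteq X$: $\delta(x,\{x\})=1$; $\delta(x,\varnothing)=0$; $\delta(x,A\cup B)=\delta(x,A)\vee\delta(x,B)$; and $\big(\bigwedge_{b\in B}\delta(b,A)\big)\,\&\,\delta(x,B)\le\delta(x,A)$. A map $f\colon(X,\delta_X)\to(Y,\delta_Y)$ is continuous if $\delta_X(x,A)\le\delta_Y(f(x),f(A))$ for all $x\in X$, $A\subseteq X$. A subspace is a subset with the restricted structure. A space $Z$ is injective if, for every $[0,1]$-approach space $X$, each continuous map to $Z$ from a subspace of $X$ extends to a continuous map $X\to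 Z$. For a $[0,1]$-ordered set $X$, the $[0,1]$-approach space $\Sigma X$ is the set $X$ with the Scott $[0,1]$-approach structure $$\delta(x,A)=\bigwedge\{\phi(x)\mid \phi \text{ a Scott closed weight of } X,\ \phi(a)=1\text{ for all }a\in A\}.$$ Then the $[0,1]$-approach space $\Sigma([0,1],\alpha_L)$ is injective if and only if $\&$ is isomorphic to the Łukasiewicz t-norm $x\,\&_{Ł}\,y=\max\{0,x+y-1\}$, i.e. if and only if there is an order isomorphism $e\colon[0,1]\to[0,1]$ with $e(x\,\&\,y)=e(x)\,\&_{Ł}\,e(y)$ for all $x,y\in[0,1]$. -/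

import Mathlib

open unitInterval

universe u v w

/-- A continuous t-norm: a continuous binary operation on `[0,1]` which makes `([0,1], mul, 1)` a
commutative unital quantale. -/
structure ContinuousTNorm where
  mul : I → I → I
  mul_assoc : ∀ a b c, mul (mul a b) c = mul a (mul b c)
  mul_comm : ∀ a b, mul a b = mul b a
  one_mul : ∀ a, mul 1 a = a
  mul_sSup : ∀ (a : I) (S : Set I), mul a (sSup S) = ⨆ b ∈ S, mul a b
  continuous_mul : Continuous fun p : I × I => mul p.1 p.2

namespace ContinuousTNorm

variable (T : ContinuousTNorm)

/-- The implication operator: `imp p r` is the largest `q` with `mul p q ≤ r`. -/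
noncomputable def imp (p r : I) : I := sSup {q | T.mul p q ≤ r}

theorem mul_one (a : I) : T.mul a 1 = a := by rw [T.mul_comm, T.one_mul]

theorem mul_le_mul_left {a b : I} (c : I) (h : a ≤ b) : T.mul c a ≤ T.mul c b := by
  have h1 : sSup {a, b} = b := by rw [sSup_pair]; exact sup_eq_right.2 h
  rw [← h1, T.mul_sSup]
  exact le_iSup₂_of_le a (by simp) le_rfl

theorem mul_le_mul {a b c d : I} (h : a ≤ b) (h' : c ≤ d) : T.mul a c ≤ T.mul b d := by
  refine (T.mul_le_mul_left a h').trans ?_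
  rw [T.mul_comm a, T.mul_comm b]
  exact T.mul_le_mul_left d h

/-- The adjoint property of the implication operator. -/
theorem le_imp_iff {p q r : I} : q ≤ T.imp p r ↔ T.mul p q ≤ r := by
  constructor
  · intro h
    refine (T.mul_le_mul_left p h).trans ?_
    rw [imp, T.mul_sSup]
    exact iSup₂_le fun b hb => hb
  · intro h
    exact le_sSup h

theorem mul_imp_le (p r : I) : T.mul p (T.imp p r) ≤ r := T.le_imp_iff.1 le_rfl

theorem one_imp (r : I) : T.imp 1 r = r := by
  refine le_antisymm ?_ ?_
  · have := T.mul_imp_le 1 r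
    rwa [T.one_mul] at this
  · rw [T.le_imp_iff, T.one_mul]

theorem mul_iSup {ι : Sort*} (a : I) (f : ι → I) : T.mul a (⨆ i, f i) = ⨆ i, T.mul a (f i) := by
  rw [iSup, T.mul_sSup, iSup_range]

/-- Isomorphism of the quantales `([0,1], T.mul, 1)` and `([0,1], T'.mul, 1)`. -/
def IsIsomorphic (T T' : ContinuousTNorm) : Prop :=
  ∃ e : I ≃o I, ∀ x y, e (T.mul x y) = T'.mul (e x) (e y)

/-- The value `max 0 (x + y - 1)` of the Łukasiewicz t-norm. -/
def lukasiewiczMul (x y : I) : I :=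
  ⟨max 0 ((x : ℝ) + y - 1), le_max_left _ _, max_le zero_le_one (by linarith [x.2.2, y.2.2])⟩

/-- The Łukasiewicz t-norm `x & y = max 0 (x + y - 1)`. -/
def lukasiewicz : ContinuousTNorm where
  mul := lukasiewiczMul
  mul_assoc a b c := by
    apply Subtype.ext
    have ha := a.2.2
    have hc := c.2.2
    simp only [lukasiewiczMul]
    rcases le_total 0 ((a : ℝ) + b - 1) with h | h <;>
      rcases le_total 0 ((b : ℝ) + c - 1) with h' | h' <;>
      simp only [max_eq_right, max_eq_left, h, h']
    · congr 1; ring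
    · rw [max_eq_left, max_eq_left] <;> linarith
    · rw [max_eq_left, max_eq_left] <;> linarith
    · rw [max_eq_left, max_eq_left] <;> linarith
  mul_comm a b := by
    apply Subtype.ext
    simp only [lukasiewiczMul, add_comm]
  one_mul a := by
    apply Subtype.ext
    have ha := a.2.1
    simp only [lukasiewiczMul, Set.Icc.coe_one, add_sub_cancel_left]
    exact max_eq_right ha
  mul_sSup a S := by
    have hcont : Continuous fun b : I => lukasiewiczMul a b := by
      unfold lukasiewiczMul
      fun_prop
    have hmono : Monotone fun b : I => lukasiewiczMul a b := by
      intro b c h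
      have h' : (b : ℝ) ≤ c := h
      exact max_le_max le_rfl (sub_le_sub_right (add_le_add_right h' _) _)
    have hbot : lukasiewiczMul a ⊥ = ⊥ := by
      apply Subtype.ext
      have ha := a.2.2
      change max 0 ((a : ℝ) + 0 - 1) = 0
      exact max_eq_left (by linarith)
    have := hmono.map_sSup_of_continuousAt (s := S) hcont.continuousAt hbot
    rw [this, sSup_image]
  continuous_mul := by
    unfold lukasiewiczMul
    fun_prop

end ContinuousTNorm

/-- A `[0,1]`-order on `X` with respect to the t-norm `T`. -/
structure QOrder (T : ContinuousTNorm) (X : Type u) where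
  hom : X → X → I
  one_le_hom_self : ∀ x, 1 ≤ hom x x
  mul_hom_le : ∀ x y z, T.mul (hom y z) (hom x y) ≤ hom x z

namespace QOrder

variable {T : ContinuousTNorm}

/-- The `[0,1]`-order `α_L(x,y) = x → y` on `[0,1]`. -/
noncomputable def alphaL (T : ContinuousTNorm) : QOrder T I where
  hom x y := T.imp x y
  one_le_hom_self x := by rw [T.le_imp_iff, T.mul_one]
  mul_hom_le x y z := by
    rw [T.le_imp_iff, T.mul_comm (T.imp y z), ← T.mul_assoc]
    exact (T.mul_le_mul (T.mul_imp_le x y) le_rfl).trans (T.mul_imp_le y z)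

/-- The opposite `[0,1]`-order. -/
def op {X : Type u} (A : QOrder T X) : QOrder T X where
  hom x y := A.hom y x
  one_le_hom_self := A.one_le_hom_self
  mul_hom_le x y z := by
    rw [T.mul_comm]
    exact A.mul_hom_le z y x

/-- The `[0,1]`-order `α_R(x,y) = y → x` on `[0,1]`. -/
noncomputable def alphaR (T : ContinuousTNorm) : QOrder T I := (alphaL T).op

variable {X : Type u} {Y : Type v} (A : QOrder T X) (B : QOrder T Y)

/-- `φ` is a weight (lower fuzzy set). -/
def IsWeight (φ : X → I) : Prop := ∀ x y, T.mul (φ y) (A.hom x y) ≤ φ x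

/-- The fuzzy inclusion order `sub(φ,ψ) = ⨅ x, φ x → ψ x`. -/
noncomputable def sub (T : ContinuousTNorm) {X : Type u} (φ ψ : X → I) : I :=
  ⨅ x, T.imp (φ x) (ψ x)

/-- `a` is a supremum of the weight `φ`: `X(a,y) = sub(φ, X(-,y))` for all `y`. -/
def IsSupremum (φ : X → I) (a : X) : Prop := ∀ y, A.hom a y = sub T φ fun x => A.hom x y

/-- The image `f^→(φ)` of a weight `φ` along a map `f` into `(Y, B)`. -/
noncomputable def push (f : X → Y) (φ : X → I) (y : Y) : I := ⨆ x, T.mul (φ x) (B.hom y (f x))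

def IsForwardCauchyNet {ι : Type w} [Preorder ι] (x : ι → X) : Prop :=
  ⨆ i, ⨅ j, ⨅ _ : i ≤ j, ⨅ l, ⨅ _ : j ≤ l, A.hom (x j) (x l) = 1

/-- A weight is forward Cauchy if it is `⨆ i, ⨅ j ≥ i, X(-, x j)` for some forward Cauchy net,
indexed by a nonempty directed preordered set. -/
def IsForwardCauchyWeight (φ : X → I) : Prop :=
  A.IsWeight φ ∧
  ∃ (ι : Type u) (_ : Preorder ι) (_ : Nonempty ι) (_ : IsDirected ι (· ≤ ·)) (x : ι → X),
    A.IsForwardCauchyNet x ∧ ∀ z, φ z = ⨆ i, ⨅ j, ⨅ _ : i ≤ j, A.hom z (x j)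

/-- `f` preserves the `[0,1]`-order and those suprema of forward Cauchy weights that exist. -/
def IsScottContinuous (f : X → Y) : Prop :=
  (∀ x y, A.hom x y ≤ B.hom (f x) (f y)) ∧
  ∀ φ, A.IsForwardCauchyWeight φ → ∀ a, A.IsSupremum φ a → B.IsSupremum (B.push f φ) (f a)

/-- Scott closed weights of `(X, A)`, the closed sets of its Scott `[0,1]`-cotopology. -/
def IsScottClosed (φ : X → I) : Prop :=
  A.IsWeight φ ∧ A.IsScottContinuous (alphaR T) φ

/-! Facts about Scott closed weights which are needed for the Scott approach structure. -/

theorem isSupremum_alphaR_iff (φ lam : X → I) (b : I) :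
    (alphaR T).IsSupremum ((alphaR T).push φ lam) b ↔ b = sub T lam φ := by
  have key : ∀ y : I, sub T ((alphaR T).push φ lam) (fun z => (alphaR T).hom z y)
      = T.imp y (sub T lam φ) := by
    intro y
    refine le_antisymm ?_ ?_
    · rw [T.le_imp_iff]
      refine le_iInf fun x => ?_
      rw [T.le_imp_iff]
      have h1 : sub T ((alphaR T).push φ lam) (fun z => (alphaR T).hom z y)
          ≤ T.imp ((alphaR T).push φ lam (φ x)) (T.imp y (φ x)) := iInf_le _ (φ x)
      have h2 : lam x ≤ (alphaR T).push φ lam (φ x) := by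
        refine le_iSup_of_le x ?_
        conv_lhs => rw [← T.mul_one (lam x)]
        exact T.mul_le_mul_left _ ((alphaR T).one_le_hom_self (φ x))
      rw [T.le_imp_iff, T.le_imp_iff] at h1
      refine le_trans ?_ h1
      rw [← T.mul_assoc, ← T.mul_assoc, T.mul_comm y]
      exact T.mul_le_mul (T.mul_le_mul h2 le_rfl) le_rfl
    · refine le_iInf fun z => ?_
      change _ ≤ T.imp _ (T.imp y z)
      rw [T.le_imp_iff, T.le_imp_iff, ← T.mul_assoc, T.mul_comm, ← T.mul_assoc, push,
        T.mul_iSup]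
      refine iSup_le fun x => ?_
      change T.mul (T.mul (T.imp y (sub T lam φ)) y) (T.mul (lam x) (T.imp (φ x) z)) ≤ z
      have h1 : T.mul (T.imp y (sub T lam φ)) y ≤ T.imp (lam x) (φ x) := by
        rw [T.mul_comm]
        exact (T.mul_imp_le _ _).trans (iInf_le _ x)
      refine (T.mul_le_mul h1 le_rfl).trans ?_
      rw [← T.mul_assoc, T.mul_comm _ (lam x)]
      exact (T.mul_le_mul (T.mul_imp_le _ _) le_rfl).trans (T.mul_imp_le _ _)
  constructor
  · intro h
    have := h 1
    rw [key] at this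
    change T.imp 1 b = _ at this
    rwa [T.one_imp, T.one_imp] at this
  · rintro rfl y
    rw [key]
    rfl

variable {A}

theorem isScottClosed_iff {φ : X → I} :
    A.IsScottClosed φ ↔ A.IsWeight φ ∧
      ∀ lam, A.IsForwardCauchyWeight lam → ∀ a, A.IsSupremum lam a → φ a = sub T lam φ := by
  constructor
  · rintro ⟨h, -, h2⟩
    exact ⟨h, fun lam hl a ha => (isSupremum_alphaR_iff φ lam _).1 (h2 lam hl a ha)⟩
  · rintro ⟨h, h2⟩
    refine ⟨h, ?_, fun lam hl a ha => (isSupremum_alphaR_iff φ lam _).2 (h2 lam hl a ha)⟩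
    intro x y
    change _ ≤ T.imp (φ y) (φ x)
    rw [T.le_imp_iff]
    exact h x y

theorem IsForwardCauchyWeight.sub_sup_le {lam : X → I} (h : A.IsForwardCauchyWeight lam)
    {φ ψ : X → I} (hφ : A.IsWeight φ) (hψ : A.IsWeight ψ) :
    sub T lam (φ ⊔ ψ) ≤ sub T lam φ ⊔ sub T lam ψ := by
  obtain ⟨-, ι, _, _, _, x, hx, hlam⟩ := h
  set t := sub T lam (φ ⊔ ψ) with ht
  rw [← T.mul_one t, ← hx, T.mul_iSup]
  refine iSup_le fun i => ?_
  set c := ⨅ j, ⨅ _ : i ≤ j, ⨅ l, ⨅ _ : j ≤ l, A.hom (x j) (x l) with hc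
  have h1 : ∀ j, i ≤ j → T.mul t c ≤ φ (x j) ⊔ ψ (x j) := by
    intro j hj
    have h2 : c ≤ lam (x j) := by
      rw [hlam]
      exact le_iSup_of_le j (iInf₂_le j hj)
    have h3 : t ≤ T.imp (lam (x j)) (φ (x j) ⊔ ψ (x j)) := iInf_le _ (x j)
    refine (T.mul_le_mul_left t h2).trans ?_
    rw [T.mul_comm]
    exact T.le_imp_iff.1 h3
  have h4 : ∀ θ : X → I, A.IsWeight θ → (∀ k, ∃ j, k ≤ j ∧ T.mul t c ≤ θ (x j)) →
      T.mul t c ≤ sub T lam θ := by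
    intro θ hθ hk
    refine le_iInf fun z => ?_
    rw [T.le_imp_iff, T.mul_comm, hlam, T.mul_iSup]
    refine iSup_le fun k => ?_
    obtain ⟨j, hj, hj'⟩ := hk k
    exact (T.mul_le_mul hj' (iInf₂_le j hj)).trans (hθ z (x j))
  by_cases hcase : ∀ k, ∃ j, k ≤ j ∧ T.mul t c ≤ φ (x j)
  · exact (h4 φ hφ hcase).trans le_sup_left
  · push Not at hcase
    obtain ⟨k, hk⟩ := hcase
    refine (h4 ψ hψ fun m => ?_).trans le_sup_right
    obtain ⟨n, hn1, hn2⟩ := exists_ge_ge i k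
    obtain ⟨j, hj1, hj2⟩ := exists_ge_ge n m
    refine ⟨j, hj2, ?_⟩
    rcases le_sup_iff.1 (h1 j (hn1.trans hj1)) with h5 | h5
    · exact absurd h5 (not_le.2 (hk j (hn2.trans hj1)))
    · exact h5

theorem IsForwardCauchyWeight.iSup_eq_one {lam : X → I} (h : A.IsForwardCauchyWeight lam) :
    ⨆ x, lam x = 1 := by
  obtain ⟨-, ι, _, _, _, x, hx, hlam⟩ := h
  refine le_antisymm le_top ?_
  rw [← hx]
  refine iSup_le fun i => ?_
  refine le_iSup_of_le (x i) ?_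
  rw [hlam]
  exact le_iSup_of_le i (iInf₂_le i le_rfl)

theorem IsScottClosed.sup {φ ψ : X → I} (hφ : A.IsScottClosed φ) (hψ : A.IsScottClosed ψ) :
    A.IsScottClosed (φ ⊔ ψ) := by
  rw [isScottClosed_iff] at *
  refine ⟨fun x y => ?_, fun lam hl a ha => ?_⟩
  · rcases le_total (φ y) (ψ y) with h | h
    · rw [Pi.sup_apply, sup_eq_right.2 h]
      exact (hψ.1 x y).trans le_sup_right
    · rw [Pi.sup_apply, sup_eq_left.2 h]
      exact (hφ.1 x y).trans le_sup_left
  · refine le_antisymm ?_ ?_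
    · have mono : ∀ θ : X → I, θ ≤ φ ⊔ ψ → sub T lam θ ≤ sub T lam (φ ⊔ ψ) := by
        intro θ hθ
        refine le_iInf fun x => T.le_imp_iff.2 ?_
        exact (T.le_imp_iff.1 (iInf_le _ x)).trans (hθ x)
      rw [Pi.sup_apply, hφ.2 lam hl a ha, hψ.2 lam hl a ha]
      exact sup_le (mono φ le_sup_left) (mono ψ le_sup_right)
    · rw [Pi.sup_apply, hφ.2 lam hl a ha, hψ.2 lam hl a ha]
      exact hl.sub_sup_le hφ.1 hψ.1

theorem isScottClosed_zero : A.IsScottClosed 0 := by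
  rw [isScottClosed_iff]
  refine ⟨fun x y => ?_, fun lam hl a _ => ?_⟩
  · have h : A.hom x y ≤ 1 := le_top
    exact (T.mul_le_mul_left 0 h).trans (T.mul_one 0).le
  · refine le_antisymm bot_le ?_
    have h : T.mul (sub T lam 0) (⨆ x, lam x) ≤ 0 := by
      rw [T.mul_iSup]
      refine iSup_le fun x => ?_
      rw [T.mul_comm, ← T.le_imp_iff]
      exact iInf_le _ x
    rwa [hl.iSup_eq_one, T.mul_one] at h

theorem IsScottClosed.imp {φ : X → I} (hφ : A.IsScottClosed φ) (p : I) :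
    A.IsScottClosed fun x => T.imp p (φ x) := by
  rw [isScottClosed_iff] at *
  refine ⟨fun x y => ?_, fun lam hl a ha => ?_⟩
  · rw [T.le_imp_iff, ← T.mul_assoc]
    exact (T.mul_le_mul (T.mul_imp_le _ _) le_rfl).trans (hφ.1 x y)
  · rw [hφ.2 lam hl a ha]
    refine le_antisymm ?_ ?_
    · refine le_iInf fun x => ?_
      rw [T.le_imp_iff, T.le_imp_iff, ← T.mul_assoc, T.mul_comm p, T.mul_assoc, ← T.le_imp_iff]
      exact (T.mul_imp_le _ _).trans (iInf_le _ x)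
    · rw [T.le_imp_iff]
      refine le_iInf fun x => ?_
      have h : sub T lam (fun x => T.imp p (φ x)) ≤ T.imp (lam x) (T.imp p (φ x)) := iInf_le _ x
      rw [T.le_imp_iff, T.le_imp_iff] at h
      rw [T.le_imp_iff, ← T.mul_assoc, T.mul_comm (lam x), T.mul_assoc]
      exact h

end QOrder

/-- A `[0,1]`-approach space structure on `X` with respect to the t-norm `T`. -/
structure QApproach (T : ContinuousTNorm) (X : Type u) where
  dist : X → Set X → I
  one_le_dist_singleton : ∀ x, 1 ≤ dist x {x}
  dist_empty : ∀ x, dist x ∅ = 0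
  dist_union : ∀ x S R, dist x (S ∪ R) = dist x S ⊔ dist x R
  le_dist : ∀ x S R, T.mul (⨅ b ∈ R, dist b S) (dist x R) ≤ dist x S

namespace QApproach

variable {T : ContinuousTNorm} {X : Type u} {Y : Type v}

def IsContinuous (D : QApproach T X) (E : QApproach T Y) (f : X → Y) : Prop :=
  ∀ x S, D.dist x S ≤ E.dist (f x) (f '' S)

/-- The subspace on a subset `Y` of `X`. -/
def subspace (D : QApproach T X) (Y : Set X) : QApproach T Y where
  dist y S := D.dist y (Subtype.val '' S)
  one_le_dist_singleton y := by
    rw [Set.image_singleton]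
    exact D.one_le_dist_singleton y
  dist_empty y := by
    rw [Set.image_empty]
    exact D.dist_empty y
  dist_union y S R := by
    rw [Set.image_union]
    exact D.dist_union y _ _
  le_dist y S R := by
    have h := D.le_dist y (Subtype.val '' S) (Subtype.val '' R)
    rwa [iInf_image] at h

/-- `(Z, E)` is injective: every continuous map into it from a subspace of an approach space
`X` (in the universe `w`) extends to a continuous map on `X`. -/
def IsInjective {Z : Type u} (E : QApproach T Z) : Prop :=
  ∀ (X : Type w) (D : QApproach T X) (Y : Set X) (f : Y → Z), (D.subspace Y).IsContinuous E f →
    ∃ g : X → Z, D.IsContinuous E g ∧ ∀ y : Y, g y = f y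

end QApproach

namespace QOrder

variable {T : ContinuousTNorm} {X : Type u}

/-- The closure of `μ` in the Scott `[0,1]`-cotopology: the meet of all Scott closed weights
above `μ`. -/
noncomputable def scottClosure (A : QOrder T X) (μ : X → I) (x : X) : I :=
  ⨅ φ : {φ : X → I // A.IsScottClosed φ ∧ μ ≤ φ}, φ.1 x

theorem indicator_le_iff (S : Set X) (φ : X → I) :
    S.indicator 1 ≤ φ ↔ ∀ a ∈ S, 1 ≤ φ a := by
  constructor
  · intro h a ha
    have := h a
    rwa [Set.indicator_of_mem ha] at this
  · intro h a
    by_cases ha : a ∈ S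
    · rw [Set.indicator_of_mem ha]
      exact h a ha
    · rw [Set.indicator_of_notMem ha]
      exact bot_le

/-- The Scott approach structure of `(X, A)`; `(X, A.scott)` is the space `Σ(X, A)`. The distance
`dist x S` is the value at `x` of the closure of the characteristic function of `S`. -/
noncomputable def scott (A : QOrder T X) : QApproach T X where
  dist x S := A.scottClosure (S.indicator 1) x
  one_le_dist_singleton x :=
    le_iInf fun φ => (indicator_le_iff _ _).1 φ.2.2 x rfl
  dist_empty x := by
    refine le_antisymm (iInf_le_of_le ⟨0, isScottClosed_zero, ?_⟩ le_rfl) bot_le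
    rw [indicator_le_iff]
    simp
  dist_union x S R := by
    refine le_antisymm ?_ (sup_le ?_ ?_)
    · by_contra hlt
      rw [not_le, sup_lt_iff] at hlt
      obtain ⟨φ, hφ⟩ := iInf_lt_iff.1 hlt.1
      obtain ⟨ψ, hψ⟩ := iInf_lt_iff.1 hlt.2
      refine absurd (sup_lt_iff.2 ⟨hφ, hψ⟩) (not_lt.2 ?_)
      refine iInf_le_of_le ⟨φ.1 ⊔ ψ.1, φ.2.1.sup ψ.2.1, ?_⟩ le_rfl
      rw [indicator_le_iff]
      rintro a (ha | ha)
      · exact ((indicator_le_iff _ _).1 φ.2.2 a ha).trans le_sup_left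
      · exact ((indicator_le_iff _ _).1 ψ.2.2 a ha).trans le_sup_right
    · refine le_iInf fun φ => iInf_le_of_le ⟨φ.1, φ.2.1, ?_⟩ le_rfl
      rw [indicator_le_iff]
      exact fun a ha => (indicator_le_iff _ _).1 φ.2.2 a (Or.inl ha)
    · refine le_iInf fun φ => iInf_le_of_le ⟨φ.1, φ.2.1, ?_⟩ le_rfl
      rw [indicator_le_iff]
      exact fun a ha => (indicator_le_iff _ _).1 φ.2.2 a (Or.inr ha)
  le_dist x S R := by
    refine le_iInf fun φ => ?_
    rw [← T.le_imp_iff]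
    refine iInf_le_of_le ⟨_, φ.2.1.imp _, ?_⟩ le_rfl
    rw [indicator_le_iff]
    intro b hb
    rw [T.le_imp_iff, T.mul_one]
    exact iInf₂_le_of_le b hb (iInf_le _ φ)

end QOrder

/-! ### Elementary facts about the t-norm and its implication -/

namespace ContinuousTNorm

variable (T : ContinuousTNorm)

/-! For nonempty `S` the Scott distance of `α_L` is `x → sup S`, so a map `f` into it is continuous
iff `f x & δ(x, S) ≤ sup f(S)` for all `x` and `S` (`isContinuous_scott_alphaL_iff`).

For the Łukasiewicz t-norm the negation is an order-reversing involution that turns this condition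
into `(inf h on S) & δ(x, S) ≤ h x`, the condition for a closed fuzzy set. Closed fuzzy sets of a
subspace extend for every continuous t-norm (`exists_closed_extension`), which gives injectivity.

Conversely, a countable test space (`not_isInjective`) shows that injectivity forbids sequences `p n
→ c` and `t n → d` with `c ≤ d` whose implications `p n → t n` stay below some `v < 1`. Suitable
sequences then exclude idempotents strictly between `0` and `1` and produce a nonzero `x` with `x &
x = 0`. These two properties characterize the Łukasiewicz t-norm: iterated square roots of `0` tend
to `1` and yield an additive generator `gen`, strictly decreasing from `1` to `0` on the unit
interval, with `gen (s + t) = gen s & gen t`. The isomorphism is the inverse of `u ↦ gen (1 - u)`.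
-/

theorem zero_mul (a : I) : T.mul 0 a = 0 :=
  le_antisymm ((T.mul_le_mul_left 0 le_top).trans (T.mul_one 0).le) bot_le

theorem mul_zero (a : I) : T.mul a 0 = 0 := by rw [T.mul_comm, T.zero_mul]

theorem mul_le_left (a b : I) : T.mul a b ≤ a :=
  (T.mul_le_mul_left a le_top).trans (T.mul_one a).le

theorem mul_le_right (a b : I) : T.mul a b ≤ b := by
  rw [T.mul_comm]
  exact T.mul_le_left b a

theorem imp_mono {p q r : I} (h : q ≤ r) : T.imp p q ≤ T.imp p r :=
  T.le_imp_iff.2 ((T.mul_imp_le p q).trans h)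

theorem imp_eq_one {p q : I} (h : p ≤ q) : T.imp p q = 1 :=
  le_antisymm le_top (T.le_imp_iff.2 ((T.mul_one p).trans_le h))

end ContinuousTNorm

/-! ### The Scott distance of `α_L` -/

namespace QOrder

variable {T : ContinuousTNorm}

theorem isScottClosed_hom {X : Type u} (A : QOrder T X) (y : X) :
    A.IsScottClosed fun x => A.hom x y :=
  isScottClosed_iff.2 ⟨fun a b => A.mul_hom_le a b y, fun _ _ _ ha => ha y⟩

/-- The net is `S` indexed by itself: it is monotone, so all its forward degrees are `1` and each
tail infimum is attained at its first index. -/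
theorem isForwardCauchyWeight_alphaL {S : Set I} (hS : S.Nonempty) :
    (alphaL T).IsForwardCauchyWeight fun z => ⨆ i : S, T.imp z i := by
  refine ⟨fun x y => ?_, S, inferInstance, hS.to_subtype, inferInstance, Subtype.val, ?_, ?_⟩
  · rw [T.mul_comm, T.mul_iSup]
    refine iSup_le fun i => le_iSup_of_le i ?_
    rw [T.mul_comm]
    exact (alphaL T).mul_hom_le x y i
  · refine le_antisymm le_top ?_
    obtain ⟨s, hs⟩ := hS
    refine le_iSup_of_le ⟨s, hs⟩ ?_
    exact le_iInf fun j => le_iInf fun _ => le_iInf fun l => le_iInf fun hl =>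
      (T.imp_eq_one hl).ge
  · intro z
    refine iSup_congr fun i => le_antisymm ?_ (iInf₂_le i le_rfl)
    exact le_iInf₂ fun j hj => T.imp_mono hj

theorem isSupremum_alphaL (S : Set I) :
    (alphaL T).IsSupremum (fun z => ⨆ i : S, T.imp z i) (sSup S) := by
  intro y
  change T.imp (sSup S) y = ⨅ z, T.imp (⨆ i : S, T.imp z i) (T.imp z y)
  refine le_antisymm (le_iInf fun z => ?_) ?_
  · rw [T.le_imp_iff, T.le_imp_iff, ← T.mul_assoc, T.mul_iSup]
    refine (T.mul_le_mul (iSup_le fun i => ?_) le_rfl).trans (T.mul_imp_le (sSup S) y)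
    exact (T.mul_imp_le z i).trans (le_sSup i.2)
  · rw [T.le_imp_iff, T.mul_comm, T.mul_sSup]
    refine iSup₂_le fun b hb => ?_
    rw [T.mul_comm, ← T.le_imp_iff]
    refine (iInf_le _ b).trans ?_
    have h : (⨆ i : S, T.imp b i) = 1 :=
      le_antisymm le_top (le_iSup_of_le ⟨b, hb⟩ (T.imp_eq_one le_rfl).ge)
    rw [h, T.one_imp]

/-- The Scott approach structure of `([0,1], α_L)`. -/
theorem scott_alphaL_dist {S : Set I} (hS : S.Nonempty) (x : I) :
    (alphaL T).scott.dist x S = T.imp x (sSup S) := by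
  refine le_antisymm ?_ ?_
  · refine iInf_le_of_le ⟨_, isScottClosed_hom (alphaL T) (sSup S), ?_⟩ le_rfl
    rw [indicator_le_iff]
    exact fun a ha => (T.imp_eq_one (le_sSup ha)).ge
  · refine le_iInf fun ⟨φ, hφ, hSφ⟩ => ?_
    rw [indicator_le_iff] at hSφ
    have hw := hφ.1
    -- Scott closedness carries the value `1` from `S` to its supremum; the weight inequality then
    -- carries it on to `x`.
    have hs : φ (sSup S) = 1 := by
      rw [(isScottClosed_iff.1 hφ).2 _ (isForwardCauchyWeight_alphaL hS) _ (isSupremum_alphaL S)]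
      refine le_antisymm le_top (le_iInf fun z => ?_)
      rw [T.le_imp_iff, T.mul_one]
      refine iSup_le fun i => ?_
      have h := hw z i
      rwa [le_antisymm le_one' (hSφ i i.2), T.one_mul] at h
    have h := hw x (sSup S)
    rwa [hs, T.one_mul] at h

end QOrder

/-! ### Continuous maps into `Σ([0,1], α_L)` and extension of closed fuzzy sets -/

namespace QApproach

variable {T : ContinuousTNorm} {X : Type u}

theorem isContinuous_scott_alphaL_iff (D : QApproach T X) (f : X → I) :
    D.IsContinuous (QOrder.alphaL T).scott f ↔
      ∀ x S, T.mul (f x) (D.dist x S) ≤ sSup (f '' S) := by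
  refine forall₂_congr fun x S => ?_
  rcases S.eq_empty_or_nonempty with rfl | hS
  · simp only [Set.image_empty, D.dist_empty, T.mul_zero]
    exact iff_of_true bot_le bot_le
  · rw [QOrder.scott_alphaL_dist (hS.image f), T.le_imp_iff]

theorem dist_mono (D : QApproach T X) (x : X) {S R : Set X} (h : S ⊆ R) :
    D.dist x S ≤ D.dist x R := by
  rw [← Set.union_eq_self_of_subset_left h, D.dist_union]
  exact le_sup_left

theorem mul_dist_biUnion_le (D : QApproach T X) (x : X) (a c : I) {ι : Type*} (F : Finset ι)
    (S : ι → Set X) (h : ∀ k ∈ F, T.mul a (D.dist x (S k)) ≤ c) :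
    T.mul a (D.dist x (⋃ k ∈ F, S k)) ≤ c := by
  classical
  induction F using Finset.induction_on with
  | empty =>
    simp only [Finset.notMem_empty, Set.iUnion_of_empty, Set.iUnion_empty, D.dist_empty,
      T.mul_zero]
    exact bot_le
  | insert k F _ ih =>
    rw [Finset.set_biUnion_insert, D.dist_union]
    rcases le_total (D.dist x (S k)) (D.dist x (⋃ k ∈ F, S k)) with h' | h'
    · rw [sup_eq_right.2 h']
      exact ih fun j hj => h j (Finset.mem_insert_of_mem hj)
    · rw [sup_eq_left.2 h']
      exact h k (Finset.mem_insert_self k F)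

/-- Closed fuzzy sets of a subspace extend to closed fuzzy sets of the whole space. -/
theorem exists_closed_extension (D : QApproach T X) (Y : Set X) (φ : Y → I)
    (hφ : ∀ y A, T.mul (⨅ a ∈ A, φ a) ((D.subspace Y).dist y A) ≤ φ y) :
    ∃ h : X → I, (∀ x B, T.mul (⨅ b ∈ B, h b) (D.dist x B) ≤ h x) ∧ ∀ y : Y, h y = φ y := by
  -- Closedness forces any extension to dominate this `h`, so it is the least candidate.
  set h : X → I := fun x => ⨆ A : Set Y, T.mul (⨅ a ∈ A, φ a) (D.dist x (Subtype.val '' A))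
   
  refine ⟨h, fun x B => ?_, fun y => le_antisymm (iSup_le fun A => hφ y A) ?_⟩
  · have hcont : Continuous fun s : I => T.mul s (D.dist x B) :=
      T.continuous_mul.comp (continuous_id.prodMk continuous_const)
    -- Each `b ∈ B` has its own witness `A'`, but a distance respects only finite unions. Giving up
    -- the gap between `s` and the infimum allows the witnesses to be replaced by finitely many
    -- level sets of `φ`.
    have key : ∀ s < ⨅ b ∈ B, h b, T.mul s (D.dist x B) ≤ h x := by
      intro s hs
      obtain ⟨r, hsr, hr⟩ := exists_between hs
      have huc := CompactSpace.uniformContinuous_of_continuous T.continuous_mul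
      obtain ⟨ε, hε, hε'⟩ := Metric.uniformContinuous_iff.1 huc ((r : ℝ) - s) (sub_pos.2 hsr)
      obtain ⟨N, hN⟩ := exists_nat_one_div_lt hε
      have hN0 : (0 : ℝ) < N + 1 := by positivity
      -- The mesh `1 / (N + 1)` is below `ε`, so rounding a factor down to the grid costs less than
      -- `r - s`. The top index `N + 1` occurs when the factor is `1`, hence the range `N + 2`
      -- below.
      let p : ℕ → I := fun k => Set.projIcc 0 1 zero_le_one (k / (N + 1) : ℝ)
      let A : ℕ → Set Y := fun k => {y | p k ≤ φ y}
      let C : ℕ → Set X := fun k => {b | s ≤ T.mul (p k) (D.dist b (Subtype.val '' A k))}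
      have hB : B ⊆ ⋃ k ∈ Finset.range (N + 2), C k := by
        intro b hb
        obtain ⟨A', hA'⟩ := lt_iSup_iff.1 (hr.trans_le (iInf₂_le b hb))
        set q := ⨅ a ∈ A', φ a with hq
        have hq0 : (0 : ℝ) ≤ q := q.2.1
        have hq1 : (q : ℝ) ≤ 1 := q.2.2
        set k := ⌊(q : ℝ) * (N + 1)⌋₊ with hk
        have hk1 : (k : ℝ) ≤ q * (N + 1) := Nat.floor_le (by positivity)
        have hk2 : (q : ℝ) * (N + 1) < k + 1 := Nat.lt_floor_add_one _
        have hk3 : (k : ℝ) / (N + 1) ≤ q := by rwa [div_le_iff₀ hN0]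
        have hpk : (p k : ℝ) = k / (N + 1) := by
          have hmem : (k / (N + 1) : ℝ) ∈ Set.Icc (0 : ℝ) 1 := ⟨by positivity, hk3.trans hq1⟩
          simp only [p, Set.projIcc_of_mem zero_le_one hmem]
        have hpq : p k ≤ q := by
          rw [← Subtype.coe_le_coe, hpk]
          exact hk3
        have hkN : k < N + 2 := by
          have : (k : ℝ) < N + 2 := by nlinarith
          exact_mod_cast this
        refine Set.mem_iUnion₂.2 ⟨k, Finset.mem_range.2 hkN, ?_⟩
        have hsub : A' ⊆ A k := fun a ha => hpq.trans (iInf₂_le a ha)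
        refine le_trans ?_ (T.mul_le_mul_left (p k) (D.dist_mono b (Set.image_mono hsub)))
        have hd : Dist.dist (q, D.dist b (Subtype.val '' A'))
            (p k, D.dist b (Subtype.val '' A')) < ε := by
          rw [Prod.dist_eq, dist_self, max_eq_left dist_nonneg, Subtype.dist_eq, Real.dist_eq,
            abs_of_nonneg (sub_nonneg.2 (Subtype.coe_le_coe.2 hpq)), hpk]
          refine lt_trans ?_ hN
          rw [sub_lt_iff_lt_add, ← add_div, lt_div_iff₀ hN0]
          linarith
        have h1 := hε' hd
        rw [Subtype.dist_eq, Real.dist_eq] at h1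
        have h2 := (abs_lt.1 h1).2
        have h3 : (r : ℝ) < T.mul q (D.dist b (Subtype.val '' A')) := hA'
        rw [← Subtype.coe_le_coe]
        linarith
      refine (T.mul_le_mul_left s (D.dist_mono x hB)).trans
        (D.mul_dist_biUnion_le x s (h x) _ C fun k _ => ?_)
      rcases (C k).eq_empty_or_nonempty with he | hne
      · rw [he, D.dist_empty, T.mul_zero]
        exact bot_le
      -- Continuity lets `&` commute with this infimum, so the triangle axiom `le_dist` can be
      -- applied to `C k` and `A k`.
      have h1 : s ≤ T.mul (p k) (⨅ b ∈ C k, D.dist b (Subtype.val '' A k)) := by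
        have hmono : Monotone fun z => T.mul (p k) z := fun _ _ h => T.mul_le_mul_left _ h
        have hc : Continuous fun z => T.mul (p k) z :=
          T.continuous_mul.comp (continuous_const.prodMk continuous_id)
        rw [iInf_subtype']
        have : Nonempty (C k) := hne.to_subtype
        refine le_of_le_of_eq (le_iInf fun b => b.2) (hmono.map_ciInf_of_continuousAt (ι := C k)
          (g := fun b => D.dist b (Subtype.val '' A k)) hc.continuousAt
          (OrderBot.bddBelow _)).symm
      refine le_trans ?_ (le_iSup _ (A k))
      refine (T.mul_le_mul h1 le_rfl).trans ?_
      rw [T.mul_assoc]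
      exact T.mul_le_mul (le_iInf₂ fun a ha => ha) (D.le_dist x _ _)
    rw [T.mul_comm, ← T.le_imp_iff]
    refine le_of_forall_lt_imp_le_of_dense fun s hs => ?_
    rw [T.le_imp_iff, T.mul_comm]
    exact key s hs
  · refine le_iSup_of_le {y} ?_
    simp only [Set.mem_singleton_iff, iInf_iInf_eq_left, Set.image_singleton]
    rw [le_antisymm le_one' (D.one_le_dist_singleton y.1), T.mul_one]

end QApproach

/-! ### The Łukasiewicz case is injective -/

namespace ContinuousTNorm

variable {T : ContinuousTNorm}

theorem IsIsomorphic.isInjective (hT : T.IsIsomorphic lukasiewicz) :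
    QApproach.IsInjective.{0, u} (QOrder.alphaL T).scott := by
  obtain ⟨e, he⟩ := hT
  intro X D Y f hf
  rw [QApproach.isContinuous_scott_alphaL_iff] at hf
  -- The Łukasiewicz negation, transported along `e`.
  let n : I → I := fun x => e.symm (σ (e x))
  have hnn : ∀ x, n (n x) = x := fun x => by simp [n]
  have hn : ∀ {x y : I}, n x ≤ n y ↔ y ≤ x := fun {x y} => by simp [n]
  -- Contraposition, together with `hsup`, exchanges continuity of `f` with closedness of `n ∘ f`.
  have hcontra : ∀ x y q, T.mul (n y) q ≤ n x ↔ T.mul x q ≤ y := by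
    intro x y q
    rw [← e.le_iff_le, ← e.le_iff_le (x := T.mul x q), he, he]
    simp only [n, OrderIso.apply_symm_apply]
    change max 0 (1 - (e y : ℝ) + e q - 1) ≤ 1 - e x ↔ max 0 ((e x : ℝ) + e q - 1) ≤ e y
    have h1 := (e x).2.2
    have h2 := (e y).2.1
    rw [max_le_iff, max_le_iff]
    constructor <;> rintro ⟨-, h⟩ <;> constructor <;> linarith
  have hsup : ∀ {ι : Type u} (S : Set ι) (g : ι → I), n (sSup (g '' S)) = ⨅ a ∈ S, n (g a) := by
    intro ι S g
    refine le_antisymm (le_iInf₂ fun a ha => hn.2 (le_sSup ⟨a, ha, rfl⟩)) ?_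
    rw [← hnn (⨅ a ∈ S, n (g a)), hn, sSup_image]
    refine iSup₂_le fun a ha => ?_
    rw [← hn, hnn]
    exact iInf₂_le a ha
  obtain ⟨h, hh, hext⟩ := D.exists_closed_extension Y (fun y => n (f y)) fun y A => by
    rw [← hsup, hcontra]
    exact hf y A
  refine ⟨fun x => n (h x), ?_, fun y => (congrArg n (hext y)).trans (hnn _)⟩
  rw [QApproach.isContinuous_scott_alphaL_iff]
  intro x S
  rw [← hcontra, hsup, hnn]
  simp only [hnn]
  exact hh x S

end ContinuousTNorm

/-! ### The test space and the obstruction to injectivity -/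

/-- The points of a test space: a sequence `base n`, a sequence `mid n` whose terms are close to
those of `base`, and a limit of both. -/
inductive TestPoint : Type u
  | lim : TestPoint
  | mid (n : ℕ) : TestPoint
  | base (n : ℕ) : TestPoint

namespace TestPoint

open Filter Topology
open scoped Classical

/-- The truth value of a proposition. -/
noncomputable def truth (P : Prop) : I := if P then 1 else 0

theorem truth_or (P Q : Prop) : truth (P ∨ Q) = truth P ⊔ truth Q := by
  by_cases hP : P <;> by_cases hQ : Q <;> simp [truth, hP, hQ]

theorem truth_of {P : Prop} (h : P) : truth P = 1 := if_pos h

theorem truth_of_not {P : Prop} (h : ¬ P) : truth P = 0 := if_neg h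

variable {T : ContinuousTNorm} {p : ℕ → I} {c : I}

/-- The distance of the test space. -/
noncomputable def testDist (p : ℕ → I) (c : I) : TestPoint.{u} → Set TestPoint.{u} → I
  | base n, S => truth (base n ∈ S)
  | mid n, S => truth (mid n ∈ S) ⊔ (p n ⊓ truth (base n ∈ S))
  | lim, S => truth (lim ∈ S) ⊔ truth (∃ᶠ n in atTop, mid n ∈ S) ⊔
      (c ⊓ truth (∃ᶠ n in atTop, base n ∈ S))

theorem testDist_eq_one_of_mem {x : TestPoint.{u}} {S : Set TestPoint.{u}} (h : x ∈ S) :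
    testDist p c x S = 1 := by
  refine le_antisymm (unitInterval.le_one _) ?_
  cases x <;> simp only [testDist, truth_of h]
  · exact le_sup_left.trans le_sup_left
  · exact le_sup_left
  · exact le_rfl

/-- The test space. -/
noncomputable def testSpace (T : ContinuousTNorm) (p : ℕ → I) (c : I)
    (hp : Tendsto p atTop (𝓝 c)) : QApproach T TestPoint.{u} where
  dist := testDist p c
  one_le_dist_singleton x := (testDist_eq_one_of_mem (Set.mem_singleton x)).ge
  dist_empty x := by
    cases x <;> simp [testDist, truth]
  dist_union x S R := by
    cases x <;> simp only [testDist, Set.mem_union, Filter.frequently_or_distrib, truth_or,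
      inf_sup_left]
    · ac_rfl
    · ac_rfl
  le_dist x S R := by
    by_cases hx : x ∈ R
    · exact (T.mul_le_left _ _).trans (iInf₂_le x hx)
    cases x with
    | base n => simp [testDist, truth_of_not hx, T.mul_zero]
    | mid n =>
      by_cases hb : base n ∈ R
      · by_cases hS : base n ∈ S
        · refine (T.mul_le_right _ _).trans ?_
          simp [testDist, truth_of_not hx, truth_of hS, truth_of hb]
        · refine (T.mul_le_left _ _).trans ((iInf₂_le _ hb).trans ?_)
          simp [testDist, truth_of_not hS]
      · simp [testDist, truth_of_not hx, truth_of_not hb, T.mul_zero]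
    | lim =>
      by_cases hm : ∃ᶠ n in atTop, mid n ∈ R
      · refine (T.mul_le_left _ _).trans ?_
        by_cases hmS : ∃ᶠ n in atTop, mid n ∈ S
        · refine (unitInterval.le_one _).trans (le_trans ?_ (le_sup_right.trans le_sup_left))
          exact (truth_of hmS).ge
        -- A point `mid n` of `R` outside `S` sees `S` only through `base n`, to degree at most `p
        -- n`. Since `p` tends to `c`, the infimum is at most `c`, exactly the degree to which `lim`
        -- sees the base sequence.
        have hlow : ∃ᶠ n in atTop, (⨅ b ∈ R, testDist p c b S) ≤ p n ⊓ truth (base n ∈ S) := by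
          refine (hm.and_eventually (not_frequently.1 hmS)).mono fun n hn => ?_
          refine (iInf₂_le _ hn.1).trans ?_
          simp [testDist, truth_of_not hn.2]
        by_cases hbS : ∃ᶠ n in atTop, base n ∈ S
        · refine le_trans ?_ le_sup_right
          rw [truth_of hbS]
          refine le_inf ?_ (unitInterval.le_one _)
          exact ge_of_tendsto_of_frequently hp (hlow.mono fun n hn => hn.trans inf_le_left)
        · obtain ⟨n, hn1, hn2⟩ := (hlow.and_eventually (not_frequently.1 hbS)).exists
          rw [truth_of_not hn2] at hn1
          exact hn1.trans (inf_le_right.trans bot_le)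
      by_cases hb : ∃ᶠ n in atTop, base n ∈ R
      · by_cases hbS : ∃ᶠ n in atTop, base n ∈ S
        · refine (T.mul_le_right _ _).trans ?_
          simp [testDist, truth_of_not hx, truth_of_not hm, truth_of hb, truth_of hbS]
        · obtain ⟨n, hn1, hn2⟩ := (hb.and_eventually (not_frequently.1 hbS)).exists
          refine (T.mul_le_left _ _).trans ((iInf₂_le _ hn1).trans ?_)
          simp [testDist, truth_of_not hn2]
      · simp [testDist, truth_of_not hx, truth_of_not hm, truth_of_not hb, T.mul_zero]

/-- Injectivity of `Σ([0,1], α_L)` gives lower semicontinuity of the implication at points where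
it takes the value `1`. -/
theorem not_isInjective (t : ℕ → I) {d v : I} (hp : Tendsto p atTop (𝓝 c))
    (ht : Tendsto t atTop (𝓝 d)) (hcd : c ≤ d) (hv : v < 1)
    (hpt : ∀ n q, T.mul (p n) q ≤ t n → q ≤ v) :
    ¬ QApproach.IsInjective.{0, u} (QOrder.alphaL T).scott := by
  intro hinj
  let D := testSpace.{u} T p c hp
  -- The value at `mid` is a dummy, as these points are left out of `Y`.
  let val : TestPoint.{u} → I
    | lim => 1
    | mid _ => 0
    | base n => t n
  let Y : Set TestPoint.{u} := {x | ∀ n, x ≠ mid n}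
  obtain ⟨g, hg, hext⟩ := hinj _ D Y (fun y => val y) <| by
    rw [QApproach.isContinuous_scott_alphaL_iff]
    intro y S
    change T.mul (val y) (testDist p c y (Subtype.val '' S)) ≤ _
    by_cases hy : y ∈ S
    · exact (T.mul_le_left _ _).trans (le_sSup ⟨y, hy, rfl⟩)
    have hy' : (y : TestPoint) ∉ Subtype.val '' S := by simpa using hy
    have hmid : ∀ n, mid n ∉ Subtype.val '' S := by
      rintro n ⟨z, -, hz⟩
      exact z.2 n hz
    obtain ⟨y, hyY⟩ := y
    cases y with
    | base n =>
      rw [testDist, truth_of_not hy', T.mul_zero]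
      exact bot_le
    | mid n => exact absurd rfl (hyY n)
    | lim =>
      by_cases hb : ∃ᶠ n in atTop, (base n : TestPoint) ∈ Subtype.val '' S
      · refine (T.mul_le_right _ _).trans ?_
        simp only [testDist, truth_of_not hy', hmid, truth_of hb, frequently_false]
        rw [truth_of_not not_false]
        refine (sup_le (sup_le bot_le bot_le) (inf_le_left.trans hcd)).trans ?_
        -- The supremum bounds `t n` infinitely often, hence also bounds the limit `d`.
        refine le_of_tendsto_of_frequently ht (hb.mono fun n hn => ?_)
        obtain ⟨z, hz, hzn⟩ := hn
        refine le_sSup ⟨z, hz, ?_⟩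
        simp only [hzn, val]
      · simp only [testDist, truth_of_not hy', hmid, truth_of_not hb, frequently_false]
        rw [truth_of_not not_false]
        simp [T.mul_zero]
  rw [QApproach.isContinuous_scott_alphaL_iff] at hg
  have hglim : g lim = 1 := hext ⟨lim, fun n h => by cases h⟩
  have hgbase : ∀ n, g (base n) = t n := fun n => hext ⟨base n, fun n h => by cases h⟩
  -- `mid n` has distance at least `p n` to `base n`, so continuity bounds its value by the
  -- implication `p n → t n`.
  have hgmid : ∀ n, g (mid n) ≤ v := by
    intro n
    refine hpt n _ ?_
    have h := hg (mid n) {base n}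
    rw [Set.image_singleton, sSup_singleton, hgbase] at h
    change T.mul _ (testDist p c (mid n) {base n}) ≤ _ at h
    rw [T.mul_comm]
    refine (T.mul_le_mul_left _ ?_).trans h
    refine le_trans ?_ le_sup_right
    rw [truth_of (Set.mem_singleton _)]
    exact le_inf le_rfl (unitInterval.le_one _)
  -- The distance from `lim` to the `mid` points is `1`, so their values, all at most `v`, would
  -- need supremum `1`.
  have h := hg lim (Set.range mid)
  rw [hglim, T.one_mul] at h
  have h1 : (1 : I) ≤ D.dist lim (Set.range mid) := by
    change _ ≤ testDist p c lim (Set.range mid)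
    refine le_trans ?_ (le_sup_right.trans le_sup_left)
    exact (truth_of (Frequently.of_forall fun n => Set.mem_range_self n)).ge
  refine absurd (h1.trans (h.trans (sSup_le ?_))) (not_le.2 hv)
  rintro _ ⟨_, ⟨n, rfl⟩, rfl⟩
  exact hgmid n

end TestPoint

/-! ### What injectivity says about the t-norm -/

namespace ContinuousTNorm

open Filter Topology

variable {T : ContinuousTNorm}

/-- Let `t n` increase strictly to `c`. Any `q > c` gives `c & q ≥ c & c = c > t n`, so the
implications `c → t n` are bounded by `c`, which is excluded when `c < 1`. -/
theorem eq_one_of_mul_self (hinj : QApproach.IsInjective.{0, u} (QOrder.alphaL T).scott) {c : I}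
    (hc0 : 0 < c) (hc : T.mul c c = c) : c = 1 := by
  by_contra hc1
  obtain ⟨t, -, ht, htc⟩ := exists_seq_strictMono_tendsto' hc0
  refine TestPoint.not_isInjective t (p := fun _ => c) tendsto_const_nhds htc le_rfl
    (lt_of_le_of_ne (unitInterval.le_one c) hc1) (fun n q h => ?_) hinj
  by_contra hq
  refine absurd (h.trans_lt (ht n).2) (not_lt.2 ?_)
  conv_lhs => rw [← hc]
  exact T.mul_le_mul_left c (not_le.1 hq).le

/-- Otherwise there are no zero divisors, as the square of the minimum of two factors lies below
their product. Then `p n → 0` is `0` for every `p n > 0`, even as `p n` tends to `0`. -/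
theorem exists_mul_self_eq_zero (hinj : QApproach.IsInjective.{0, u} (QOrder.alphaL T).scott) :
    ∃ x, 0 < x ∧ T.mul x x = 0 := by
  by_contra! h
  obtain ⟨p, -, hp, hp0⟩ := exists_seq_strictAnti_tendsto' (zero_lt_one (α := I))
  refine TestPoint.not_isInjective (fun _ => 0) hp0 tendsto_const_nhds le_rfl zero_lt_one
    (fun n q hq => ?_) hinj
  by_contra hq0
  refine h (p n ⊓ q) (lt_inf_iff.2 ⟨(hp n).1, not_le.1 hq0⟩) (le_antisymm ?_ bot_le)
  exact (T.mul_le_mul inf_le_left inf_le_right).trans hq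

end ContinuousTNorm

/-! ### The additive generator and the isomorphism with Łukasiewicz -/

namespace ContinuousTNorm

open Filter Topology
open scoped NNReal

variable (T : ContinuousTNorm)

/-- The powers of `x` with respect to the t-norm. -/
def pow (x : I) : ℕ → I
  | 0 => 1
  | n + 1 => T.mul (pow x n) x

theorem pow_add (x : I) (m n : ℕ) : T.pow x (m + n) = T.mul (T.pow x m) (T.pow x n) := by
  induction n with
  | zero => exact (T.mul_one _).symm
  | succ n ih => rw [← add_assoc, pow, ih, T.mul_assoc, pow]

theorem pow_one (x : I) : T.pow x 1 = x := T.one_mul x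

theorem pow_antitone (x : I) : Antitone (T.pow x) :=
  antitone_nat_of_succ_le fun _ => T.mul_le_left _ _

theorem continuous_mul_self : Continuous fun x => T.mul x x :=
  T.continuous_mul.comp (continuous_id.prodMk continuous_id)

/-- The largest square root of `x` with respect to the t-norm. -/
noncomputable def sqrt (x : I) : I := sSup {y | T.mul y y ≤ x}

theorem mul_self_le_iff {x y : I} : T.mul y y ≤ x ↔ y ≤ T.sqrt x := by
  have hcl : IsClosed {y | T.mul y y ≤ x} := isClosed_le T.continuous_mul_self continuous_const
  have hne : {y | T.mul y y ≤ x}.Nonempty := ⟨0, (T.zero_mul 0).trans_le bot_le⟩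
  refine ⟨fun h => le_sSup h, fun h => ?_⟩
  exact (T.mul_le_mul h h).trans (hcl.sSup_mem hne)

/-- Squaring is continuous and fixes `0` and `1`, so the intermediate value theorem supplies some
root, which the largest one dominates. -/
theorem sqrt_mul_sqrt (x : I) : T.mul (T.sqrt x) (T.sqrt x) = x := by
  obtain ⟨y, -, hy⟩ := intermediate_value_Icc (bot_le : (0 : I) ≤ 1)
    T.continuous_mul_self.continuousOn
    (show x ∈ Set.Icc (T.mul 0 0) (T.mul 1 1) by
      rw [T.zero_mul, T.one_mul]; exact ⟨bot_le, unitInterval.le_one x⟩)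
  refine le_antisymm (T.mul_self_le_iff.2 le_rfl) ?_
  have h := T.mul_self_le_iff.1 hy.le
  exact hy.ge.trans (T.mul_le_mul h h)

/-- Iterated square roots of `0`. -/
noncomputable def root : ℕ → I
  | 0 => 0
  | n + 1 => T.sqrt (root n)

theorem root_mul_root (n : ℕ) : T.mul (T.root (n + 1)) (T.root (n + 1)) = T.root n :=
  T.sqrt_mul_sqrt _

theorem root_monotone : Monotone T.root :=
  monotone_nat_of_le_succ fun n => (T.root_mul_root n).symm.trans_le (T.mul_le_left _ _)

theorem pow_root (n k : ℕ) : T.pow (T.root (n + 1)) (2 * k) = T.pow (T.root n) k := by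
  induction k with
  | zero => rfl
  | succ k ih => rw [mul_add, T.pow_add, ih, pow, ← T.root_mul_root n]; simp [pow, T.one_mul]

/-- The additive generator of `T`: the one-parameter semigroup with value `root n` at `1 / 2^n`. -/
noncomputable def gen (s : ℝ≥0) : I := ⨅ n : ℕ, T.pow (T.root n) ⌊s * 2 ^ n⌋₊

theorem gen_antitone : Antitone T.gen := fun s t h =>
  iInf_mono fun n => T.pow_antitone _ (Nat.floor_mono (by gcongr))

/-- Refining the dyadic level at least doubles the floor, so by `pow_root` the sequence decreases to
its infimum. -/
theorem tendsto_gen (s : ℝ≥0) :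
    Tendsto (fun n : ℕ => T.pow (T.root n) ⌊s * 2 ^ n⌋₊) atTop (𝓝 (T.gen s)) := by
  refine tendsto_atTop_iInf (antitone_nat_of_succ_le fun n => ?_)
  rw [← T.pow_root n]
  refine T.pow_antitone _ (Nat.le_floor ?_)
  push_cast
  rw [_root_.pow_succ', mul_left_comm]
  gcongr
  exact Nat.floor_le zero_le

theorem gen_zero : T.gen 0 = 1 := by simp [gen, pow]

theorem gen_one : T.gen 1 = 0 := by
  refine le_antisymm (iInf_le_of_le 0 ?_) bot_le
  simp [root, T.pow_one]

theorem gen_eq_zero {s : ℝ≥0} (h : 1 ≤ s) : T.gen s = 0 :=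
  le_antisymm ((T.gen_antitone h).trans T.gen_one.le) bot_le

/-- From level `m` on the floors are exact and the approximating sequence is constant. -/
theorem gen_inv_two_pow (m : ℕ) : T.gen (2⁻¹ ^ m) = T.root m := by
  have h : ∀ n, T.pow (T.root (n + m)) (2 ^ n) = T.root m := by
    intro n
    induction n with
    | zero => rw [zero_add]; exact T.pow_one _
    | succ n ih => rw [add_right_comm, _root_.pow_succ', T.pow_root, ih]
  refine tendsto_nhds_unique ((tendsto_add_atTop_iff_nat m).2 (T.tendsto_gen (2⁻¹ ^ m))) ?_
  refine tendsto_const_nhds.congr fun n => ?_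
  have h2 : (2⁻¹ ^ m : ℝ≥0) * 2 ^ (n + m) = ((2 ^ n : ℕ) : ℝ≥0) := by
    push_cast
    rw [_root_.pow_add, mul_left_comm, ← mul_pow, inv_mul_cancel₀ two_ne_zero, one_pow,
      _root_.mul_one]
  rw [h2, Nat.floor_natCast, h]

theorem gen_half : T.gen 2⁻¹ = T.root 1 := by
  rw [← T.gen_inv_two_pow, _root_.pow_one]

variable {T}
theorem root_one_pos (hnil : ∃ x, 0 < x ∧ T.mul x x = 0) : 0 < T.root 1 := by
  obtain ⟨x, hx, hxx⟩ := hnil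
  exact hx.trans_le (T.mul_self_le_iff.1 hxx.le)

/-- The limit of the increasing roots is idempotent and at least `root 1 > 0`. -/
theorem tendsto_root (hidem : ∀ c, 0 < c → T.mul c c = c → c = 1)
    (hnil : ∃ x, 0 < x ∧ T.mul x x = 0) : Tendsto T.root atTop (𝓝 1) := by
  have h := tendsto_atTop_iSup T.root_monotone
  have h' : Tendsto (fun n => T.mul (T.root (n + 1)) (T.root (n + 1))) atTop
      (𝓝 (T.mul (⨆ n, T.root n) (⨆ n, T.root n))) :=
    (T.continuous_mul_self.tendsto _).comp ((tendsto_add_atTop_iff_nat 1).2 h)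
  simp only [root_mul_root] at h'
  rwa [← hidem _ ((root_one_pos hnil).trans_le (le_iSup T.root 1)) (tendsto_nhds_unique h' h)]

/-- The floor of a sum exceeds the sum of the floors by at most `1`, and one extra factor `root n`
is harmless because it tends to `1`. -/
theorem gen_add (hidem : ∀ c, 0 < c → T.mul c c = c → c = 1)
    (hnil : ∃ x, 0 < x ∧ T.mul x x = 0) (s t : ℝ≥0) : T.gen (s + t) = T.mul (T.gen s) (T.gen t) := by
  have h1 : Tendsto (fun n : ℕ => T.pow (T.root n) (⌊s * 2 ^ n⌋₊ + ⌊t * 2 ^ n⌋₊)) atTop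
      (𝓝 (T.mul (T.gen s) (T.gen t))) := by
    simp only [T.pow_add]
    exact (T.continuous_mul.tendsto (T.gen s, T.gen t)).comp
      ((T.tendsto_gen s).prodMk_nhds (T.tendsto_gen t))
  have h2 : Tendsto (fun n : ℕ => T.pow (T.root n) (⌊s * 2 ^ n⌋₊ + ⌊t * 2 ^ n⌋₊ + 1)) atTop
      (𝓝 (T.mul (T.gen s) (T.gen t))) := by
    have := (T.continuous_mul.tendsto (T.mul (T.gen s) (T.gen t), 1)).comp
      (h1.prodMk_nhds (tendsto_root hidem hnil))
    rwa [T.mul_one] at this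
  refine tendsto_nhds_unique (T.tendsto_gen (s + t))
    (tendsto_of_tendsto_of_tendsto_of_le_of_le h2 h1 (fun n => ?_) fun n => ?_)
  · refine T.pow_antitone _ (Nat.le_of_lt_succ ((Nat.floor_lt zero_le).2 ?_))
    push_cast
    have hs := Nat.lt_floor_add_one (s * 2 ^ n)
    have ht := Nat.lt_floor_add_one (t * 2 ^ n)
    calc (s + t) * 2 ^ n = s * 2 ^ n + t * 2 ^ n := add_mul _ _ _
      _ < (⌊s * 2 ^ n⌋₊ + 1) + (⌊t * 2 ^ n⌋₊ + 1) := add_lt_add hs ht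
      _ = _ := by ring
  · refine T.pow_antitone _ (Nat.le_floor ?_)
    push_cast
    rw [add_mul]
    exact add_le_add (Nat.floor_le zero_le) (Nat.floor_le zero_le)

/-- If adding `d` does not change the value, neither does adding `m * d`, and `gen` vanishes once `m
* d ≥ 1`. -/
theorem gen_eq_zero_of_eq (hidem : ∀ c, 0 < c → T.mul c c = c → c = 1)
    (hnil : ∃ x, 0 < x ∧ T.mul x x = 0) {s t : ℝ≥0} (hst : s < t) (h : T.gen s = T.gen t) :
    T.gen s = 0 := by
  obtain ⟨d, hd, rfl⟩ : ∃ d, 0 < d ∧ s + d = t :=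
    ⟨t - s, tsub_pos_of_lt hst, add_tsub_cancel_of_le hst.le⟩
  rw [gen_add hidem hnil] at h
  have hm : ∀ m : ℕ, T.gen s = T.mul (T.gen s) (T.gen (m * d)) := by
    intro m
    induction m with
    | zero => simp [gen_zero, T.mul_one]
    | succ m ih =>
      rw [Nat.cast_succ, add_mul, _root_.one_mul, gen_add hidem hnil, ← T.mul_assoc, ← ih, ← h]
  obtain ⟨m, hm'⟩ := exists_nat_ge d⁻¹
  have h1 : T.gen (m * d) = 0 := T.gen_eq_zero (by rwa [← div_le_iff₀ hd, one_div])
  rw [hm m, h1, T.mul_zero]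

/-- If `gen s = 0`, then `gen (s / 2)` squares to `0`, so it is at most the largest such element
`root 1 = gen 2⁻¹`. Antitonicity makes the two equal although `s / 2 < 2⁻¹`, and the previous lemma
gives `root 1 = 0`. -/
theorem gen_pos (hidem : ∀ c, 0 < c → T.mul c c = c → c = 1)
    (hnil : ∃ x, 0 < x ∧ T.mul x x = 0) {s : ℝ≥0} (hs : s < 1) : T.gen s ≠ 0 := by
  intro h
  have h1 : T.mul (T.gen (s / 2)) (T.gen (s / 2)) = 0 := by
    rw [← gen_add hidem hnil, add_halves, h]
  have hlt : s / 2 < 2⁻¹ := by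
    rw [div_eq_mul_inv]
    exact (mul_lt_iff_lt_one_left (by positivity)).2 hs
  have heq : T.gen (s / 2) = T.gen 2⁻¹ :=
    le_antisymm (T.gen_half ▸ T.mul_self_le_iff.1 h1.le) (T.gen_antitone hlt.le)
  have h0 := gen_eq_zero_of_eq hidem hnil hlt heq
  rw [heq, gen_half] at h0
  exact (root_one_pos hnil).ne' h0

theorem gen_strictAntiOn (hidem : ∀ c, 0 < c → T.mul c c = c → c = 1)
    (hnil : ∃ x, 0 < x ∧ T.mul x x = 0) : StrictAntiOn T.gen (Set.Iic 1) := fun _ _ _ ht hst =>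
  lt_of_le_of_ne (T.gen_antitone hst.le) fun h =>
    gen_pos hidem hnil (hst.trans_le ht) (gen_eq_zero_of_eq hidem hnil hst h.symm)

theorem tendsto_gen_inv_two_pow (hidem : ∀ c, 0 < c → T.mul c c = c → c = 1)
    (hnil : ∃ x, 0 < x ∧ T.mul x x = 0) :
    Tendsto (fun n : ℕ => T.gen (2⁻¹ ^ n)) atTop (𝓝 1) := by
  simpa only [T.gen_inv_two_pow] using tendsto_root hidem hnil

theorem exists_gen_eq (hidem : ∀ c, 0 < c → T.mul c c = c → c = 1)
    (hnil : ∃ x, 0 < x ∧ T.mul x x = 0) (x : I) : ∃ s ≤ 1, T.gen s = x := by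
  rcases eq_or_lt_of_le (bot_le : (0 : I) ≤ x) with rfl | hx
  · exact ⟨1, le_rfl, T.gen_one⟩
  have hlim := tendsto_gen_inv_two_pow hidem hnil
  let S : Set ℝ≥0 := {s | x ≤ T.gen s}
  have hS1 : ∀ s ∈ S, s ≤ 1 := fun s hs => by
    by_contra h
    exact not_lt.2 (hs.trans (T.gen_eq_zero (not_le.1 h).le).le) hx
  have hne : S.Nonempty := ⟨0, (unitInterval.le_one x).trans T.gen_zero.ge⟩
  have hbdd : BddAbove S := ⟨1, hS1⟩
  have hmul : ∀ y, Tendsto (fun n : ℕ => T.mul y (T.gen (2⁻¹ ^ n))) atTop (𝓝 y) := fun y => by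
    have := (T.continuous_mul.tendsto (y, 1)).comp (tendsto_const_nhds.prodMk_nhds hlim)
    rwa [T.mul_one] at this
  -- Continuity of `gen` is replaced by shifts of `2⁻¹ ^ n`: each multiplies the value by a factor
  -- tending to `1`.
  refine ⟨sSup S, csSup_le hne hS1, le_antisymm ?_ ?_⟩
  · refine le_of_tendsto (hmul _) (Eventually.of_forall fun n => ?_)
    rw [← gen_add hidem hnil]
    by_contra h
    exact absurd (le_csSup hbdd (not_le.1 h).le) (not_le.2 (lt_add_of_pos_right _ (by positivity)))
  · refine le_of_tendsto (hmul x) (Eventually.of_forall fun n => ?_)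
    obtain ⟨s, hs, hlt⟩ : ∃ s ∈ S, sSup S < s + 2⁻¹ ^ n := by
      -- Subtraction in `ℝ≥0` truncates, so a small supremum is treated separately.
      by_cases h : sSup S < 2⁻¹ ^ n
      · exact ⟨_, hne.some_mem, h.trans_le le_add_self⟩
      obtain ⟨s, hs, hlt⟩ := exists_lt_of_lt_csSup hne
        (tsub_lt_self (lt_of_lt_of_le (by positivity) (not_lt.1 h))
          (by positivity : (0 : ℝ≥0) < 2⁻¹ ^ n))
      exact ⟨s, hs, (tsub_lt_iff_right (not_lt.1 h)).1 hlt⟩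
    refine (T.mul_le_mul hs le_rfl).trans ?_
    rw [← gen_add hidem hnil]
    exact T.gen_antitone hlt.le

theorem isIsomorphic_lukasiewicz (hidem : ∀ c, 0 < c → T.mul c c = c → c = 1)
    (hnil : ∃ x, 0 < x ∧ T.mul x x = 0) : T.IsIsomorphic lukasiewicz := by
  let f : I → ℝ≥0 := fun u => ⟨(σ u : I), (σ u).2.1⟩
  let G : I → I := fun u => T.gen (f u)
  have hmono : StrictMono G := fun u v h =>
    gen_strictAntiOn hidem hnil (show (1 - v : ℝ) ≤ 1 from sub_le_self _ v.2.1)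
      (show (1 - u : ℝ) ≤ 1 from sub_le_self _ u.2.1) (show (1 - v : ℝ) < 1 - u from
        sub_lt_sub_left (Subtype.coe_lt_coe.2 h) 1)
  have hsurj : Function.Surjective G := fun x => by
    obtain ⟨s, hs, rfl⟩ := exists_gen_eq hidem hnil x
    refine ⟨σ ⟨s, s.2, hs⟩, ?_⟩
    simp only [G, f, unitInterval.symm_symm]
    rfl
  have hG : ∀ u v, G (lukasiewicz.mul u v) = T.mul (G u) (G v) := by
    intro u v
    rw [← gen_add hidem hnil]
    have hval : ((f (lukasiewicz.mul u v) : ℝ≥0) : ℝ) = 1 - max 0 ((u : ℝ) + v - 1) := rfl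
    have huv : ((f u + f v : ℝ≥0) : ℝ) = (1 - u) + (1 - v) := rfl
    -- Truncation at `0` in the Łukasiewicz product corresponds to `gen` being `0` from `1` onwards.
    rcases le_total ((u : ℝ) + v - 1) 0 with h | h
    · rw [max_eq_left h] at hval
      change T.gen _ = _
      rw [T.gen_eq_zero, T.gen_eq_zero]
      · rw [← NNReal.coe_le_coe, huv, NNReal.coe_one]; linarith
      · rw [← NNReal.coe_le_coe, hval, NNReal.coe_one]; linarith
    · rw [max_eq_right h] at hval
      change T.gen _ = _
      congr 1
      rw [← NNReal.coe_inj, huv, hval]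
      ring
  let E := hmono.orderIsoOfSurjective G hsurj
  refine ⟨E.symm, fun x y => ?_⟩
  rw [E.symm_apply_eq]
  change _ = G _
  rw [hG]
  exact congrArg₂ T.mul (E.apply_symm_apply x).symm (E.apply_symm_apply y).symm

end ContinuousTNorm

theorem mainTheorem9 (T : ContinuousTNorm) :
    QApproach.IsInjective.{0, u} (QOrder.alphaL T).scott ↔
      T.IsIsomorphic ContinuousTNorm.lukasiewicz := by
  refine ⟨fun h => ?_, ContinuousTNorm.IsIsomorphic.isInjective⟩
  exact ContinuousTNorm.isIsomorphic_lukasiewicz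
    (fun c => ContinuousTNorm.eq_one_of_mul_self h) (ContinuousTNorm.exists_mul_self_eq_zero h)
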